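/- Let $f:\mathbb{R}^n\to\mathbb{R}$, $c:\mathbb{R}^n\to\mathbb{R}^p$, $A\in\mathbb{R}^{q\times n}$, $B\in\mathbb{R}^{q\times m}$, $b\in\mathbb{R}^q$, and consider the problem $$\min_{x,y}\ f(x)\quad\text{subject to}\quad c(x)=0,\ \ Ax+By=b .$$ Write $\nabla c(x)^{\mathrm T}$ for the Jacobian of $c$ at $x$, and $\|\cdot\|$ for the Euclidean norm. Assume that $f$ and $c$ are continuously differentiable, and that $(x^*,y^*,\mu^*,\lambda^*)$ is a KKT point of the problem, i.e. $$\nabla f(x^*)+\nabla c(x^*)\mu^*+A^{\mathrm T}\lambda^*=0,\quad B^{\mathrm T}\lambda^*=0,\quad c(x^*)=0,\quad Ax^*+By^*=b .$$ Assume that $f$ and $c$ are twice continuously differentiable on some neighborhood of $x^*$, that the rows of $$C=\begin{bmatrix}\nabla c(x^*)^{\mathrm T}&0\\A&B\end{bmatrix}$$ are linearly independent, and that, with $H=\nabla^2 f(x^*)+\sum_j\mu^*_j\nabla^2c_j(x^*)$, $$z^{\mathrm T}\begin{bmatrix}H&0\\0&0\end{bmatrix}z>0\quad\text{for all } z\ne0\text{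 with }Cz=0 .$$ For $\rho>0$, consider any infinite sequence of iterates generated as follows (no stopping test being applied): $y^0\in\mathbb{R}^m$ and $\lambda^0\in\mathbb{R}^q$ with $B^{\mathrm T}\lambda^0=0$ are given, and for $k=0,1,2,\dots$ * $x^{k+1}$ is a local minimum of the subproblem of minimizing $f(x)+(\lambda^k)^{\mathrm T}(Ax+By^k-b)+\frac{\rho}{2}\|Ax+By^k-b\|^2$ over $x$ subject to $c(x)=0$, and $\mu^{k+1}\in\mathbb{R}^p$ is such that $(x^{k+1},\mu^{k+1})$ is a KKT point of this subproblem, i.e. $c(x^{k+1})=0$ and $\nabla f(x^{k+1})+\nabla c(x^{k+1})\mu^{k+1}+A^{\mathrm T}\big(\lambda^k+\rho(Ax^{k+1}+By^k-b)\big)=0$; * $y^{k+1}$ minimizes $(\lambda^k)^{\mathrm T}(Ax^{k+1}+By-b)+\frac{\rho}{2}\|Ax^{k+1}+By-b\|^2$ over $y\in\mathbb{R}^m$; * $\lambda^{k+1}=\lambda^k+\rho(Ax^{k+1}+By^{k+1}-b)$. Then there exist constants $\epsilon>0$ and $\rho^*>0$, depending only on the problem data $f,c,A,B,b$ and on $(x^*,y^*,\mu^*,\lambda^*)$,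 such that for every $\rho>\rho^*$ and every such sequence of iterates: if $\|(x^{k+1},y^{k+1},\mu^{k+1},\lambda^{k+1})-(x^*,y^*,\mu^*,\lambda^*)\|<\epsilon$ for all sufficiently large $k$, then $(x^{k+1},y^{k+1},\mu^{k+1},\lambda^{k+1})\to(x^*,y^*,\mu^*,\lambda^*)$ as $k\to\infty$. -/

import Mathlib

noncomputable section

namespace ADMM

/-- Euclidean space `ℝⁿ` with the 2-norm. -/
abbrev Vec (n : ℕ) := EuclideanSpace ℝ (Fin n)

/-- The matrix-vector product `M v`, as a vector of Euclidean space. -/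
abbrev mv {k l : ℕ} (M : Matrix (Fin k) (Fin l) ℝ) (v : Vec l) : Vec k :=
  Matrix.toEuclideanLin M v

/-- The `i`-th standard basis vector of `ℝⁿ`. -/
def basisVec {n : ℕ} (i : Fin n) : Vec n := EuclideanSpace.single i (1 : ℝ)

/-- The Jacobian matrix `∇c(x)ᵀ` of a vector-valued map: entry `(j, i)` is `∂c_j/∂x_i (x)`. -/
def jacobian {n p : ℕ} (c : Vec n → Vec p) (x : Vec n) : Matrix (Fin p) (Fin n) ℝ :=
  Matrix.of fun j i => (fderiv ℝ c x (basisVec i)) j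

/-- The Hessian matrix `∇²g(x)` of a real-valued function: entry `(i, j)` is
`∂²g/∂x_i∂x_j (x)`. -/
def hessian {n : ℕ} (g : Vec n → ℝ) (x : Vec n) : Matrix (Fin n) (Fin n) ℝ :=
  Matrix.of fun i j => fderiv ℝ (fderiv ℝ g) x (basisVec i) (basisVec j)

/-- The data of the problem `min f(x)` over `(x, y)` subject to `c(x) = 0`, `A x + B y = b`. -/
structure Problem (n m p q : ℕ) where
  f : Vec n → ℝ
  c : Vec n → Vec p
  A : Matrix (Fin q) (Fin n) ℝ
  B : Matrix (Fin q) (Fin m) ℝ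
  b : Vec q

namespace Problem

variable {n m p q : ℕ} (P : Problem n m p q)

/-- The violation `A x + B y - b` of the linear constraint. -/
def linRes (x : Vec n) (y : Vec m) : Vec q := mv P.A x + mv P.B y - P.b

/-- The terms `λᵀ (A x + B y - b) + (ρ/2) ‖A x + B y - b‖²`. -/
def penalty (ρ : ℝ) (lam : Vec q) (x : Vec n) (y : Vec m) : ℝ :=
  inner ℝ lam (P.linRes x y) + ρ / 2 * ‖P.linRes x y‖ ^ 2

/-- `(x, y, μ, λ)` is a KKT point of the problem. -/
structure IsKKT (x : Vec n) (y : Vec m) (μ : Vec p) (lam : Vec q) : Prop where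
  stationary_x : gradient P.f x + mv (jacobian P.c x).transpose μ + mv P.A.transpose lam = 0
  stationary_y : mv P.B.transpose lam = 0
  feasible_c : P.c x = 0
  feasible_lin : mv P.A x + mv P.B y = P.b

/-- `x` is a local minimum of the ADMM subproblem with parameters `ρ`, `y`, `λ`: minimize
`f(x) + λᵀ (A x + B y - b) + (ρ/2) ‖A x + B y - b‖²` subject to `c(x) = 0`. -/
def IsSubproblemLocalMin (ρ : ℝ) (y : Vec m) (lam : Vec q) (x : Vec n) : Prop :=
  P.c x = 0 ∧ IsLocalMinOn (fun x' => P.f x' + P.penalty ρ lam x' y) {x' | P.c x' = 0} x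

/-- `(x, μ)` is a KKT point of the ADMM subproblem with parameters `ρ`, `y`, `λ`. -/
structure IsSubproblemKKT (ρ : ℝ) (y : Vec m) (lam : Vec q) (x : Vec n) (μ : Vec p) :
    Prop where
  stationary : gradient P.f x + mv (jacobian P.c x).transpose μ
    + mv P.A.transpose (lam + ρ • P.linRes x y) = 0
  feasible : P.c x = 0

/-- `(x^k)`, `(y^k)`, `(λ^k)` are iterates of ADMM with penalty parameter `ρ`, the stopping test
being disregarded. The values `y 0`, `lam 0` are the initial guesses; `x 0` plays no role. -/
structure IsADMMSequence (ρ : ℝ) (x : ℕ → Vec n) (y : ℕ → Vec m) (lam : ℕ → Vec q) :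
    Prop where
  init : mv P.B.transpose (lam 0) = 0
  x_step : ∀ k, P.IsSubproblemLocalMin ρ (y k) (lam k) (x (k + 1))
  y_step : ∀ k, IsMinOn (fun y' => P.penalty ρ (lam k) (x (k + 1)) y') Set.univ (y (k + 1))
  lam_step : ∀ k, lam (k + 1) = lam k + ρ • P.linRes (x (k + 1)) (y (k + 1))

/-- The Jacobian `[∇c(x)ᵀ 0; A B]` of all equality constraints. -/
def constraintJacobian (x : Vec n) : Matrix (Fin p ⊕ Fin q) (Fin n ⊕ Fin m) ℝ :=
  Matrix.fromBlocks (jacobian P.c x) 0 P.A P.B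

/-- `H_xx(x, μ) = ∇²f(x) + ∑ⱼ μⱼ ∇²cⱼ(x)`. -/
def lagrangianHessian (x : Vec n) (μ : Vec p) : Matrix (Fin n) (Fin n) ℝ :=
  hessian P.f x + ∑ j, μ j • hessian (fun x' => P.c x' j) x

/-- Regularity of the problem at the primal-dual point `(x, y, μ, λ)`. -/
structure IsRegularSolution (x : Vec n) (y : Vec m) (μ : Vec p) (lam : Vec q) : Prop where
  contDiff_f : ContDiff ℝ 1 P.f
  contDiff_c : ContDiff ℝ 1 P.c
  kkt : P.IsKKT x y μ lam
  contDiff_two : ∃ U : Set (Vec n), IsOpen U ∧ x ∈ U ∧ ContDiffOn ℝ 2 P.f U ∧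
    ContDiffOn ℝ 2 P.c U
  /-- Linear independence constraint qualification. -/
  licq : LinearIndependent ℝ (P.constraintJacobian x).row
  /-- Second-order sufficient condition. -/
  sosc : ∀ z : Fin n ⊕ Fin m → ℝ, z ≠ 0 → (P.constraintJacobian x).mulVec z = 0 →
    0 < z ⬝ᵥ (Matrix.fromBlocks (P.lagrangianHessian x μ) 0 0
      (0 : Matrix (Fin m) (Fin m) ℝ)).mulVec z

end Problem

/-- The Euclidean distance between `(x, y, μ, λ)` and `(x', y', μ', λ')` in `ℝ^(n+m+p+q)`. -/
def primalDualDist {n m p q : ℕ} (x x' : Vec n) (y y' : Vec m) (μ μ' : Vec p)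
    (lam lam' : Vec q) : ℝ :=
  Real.sqrt (‖x - x'‖ ^ 2 + ‖y - y'‖ ^ 2 + ‖μ - μ'‖ ^ 2 + ‖lam - lam'‖ ^ 2)

end ADMM

end

noncomputable section

namespace ADMM

open Filter Topology

/-- Debreu's lemma: a quadratic function that is positive on the nonzero zeros of a nonnegative
quadratic function becomes positive definite after adding a large multiple of the latter. -/
theorem exists_add_mul_ge_norm_sq {E : Type*} [NormedAddCommGroup E] [NormedSpace ℝ E]
    [FiniteDimensional ℝ E] {Q R : E → ℝ} (hQ : Continuous Q) (hR : Continuous R)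
    (hQs : ∀ (t : ℝ) z, Q (t • z) = t ^ 2 * Q z) (hRs : ∀ (t : ℝ) z, R (t • z) = t ^ 2 * R z)
    (hR0 : ∀ z, 0 ≤ R z) (hpos : ∀ z, z ≠ 0 → R z = 0 → 0 < Q z) :
    ∃ σ α : ℝ, 0 < σ ∧ 0 < α ∧ ∀ z, α * ‖z‖ ^ 2 ≤ Q z + σ * R z := by
  have : ProperSpace E := FiniteDimensional.proper ℝ E
  obtain ⟨k, hk⟩ := (isCompact_sphere (0 : E) 1).elim_directed_cover
    (fun k : ℕ => {z | 1 / ((k : ℝ) + 1) < Q z + (k + 1) * R z})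
    (fun k => isOpen_lt continuous_const (by fun_prop))
    (by
      intro z hz
      have hz0 : z ≠ 0 := by
        rintro rfl
        simp at hz
      rw [Set.mem_iUnion]
      rcases (hR0 z).eq_or_lt with h | h
      · obtain ⟨k, hk⟩ := exists_nat_one_div_lt (hpos z hz0 h.symm)
        exact ⟨k, by simpa [← h] using hk⟩
      · obtain ⟨k, hk⟩ := exists_nat_gt ((1 - Q z) / R z)
        refine ⟨k, ?_⟩
        rw [div_lt_iff₀ h] at hk
        have h1 : 1 / ((k : ℝ) + 1) ≤ 1 := by
          rw [div_le_one (by positivity)]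
          linarith [(Nat.cast_nonneg k : (0 : ℝ) ≤ k)]
        simp only [Set.mem_ofPred_eq]
        nlinarith)
    (directed_of_isDirected_le (by
      intro i j hij z hz
      simp only [Set.mem_ofPred_eq] at hz ⊢
      have hij' : (i : ℝ) ≤ j := by exact_mod_cast hij
      have h1 : 1 / ((j : ℝ) + 1) ≤ 1 / ((i : ℝ) + 1) := by gcongr
      have h2 := mul_le_mul_of_nonneg_right hij' (hR0 z)
      nlinarith))
  refine ⟨k + 1, 1 / (k + 1), by positivity, by positivity, fun z => ?_⟩
  rcases eq_or_ne z 0 with rfl | hz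
  · have h1 := hQs 0 0
    have h2 := hRs 0 0
    simp only [smul_zero] at h1 h2
    rw [h1, h2]
    simp
  · have hz' : ‖z‖ ≠ 0 := norm_ne_zero_iff.2 hz
    have h := hk (show ‖z‖⁻¹ • z ∈ Metric.sphere (0 : E) 1 by simp [norm_smul, hz'])
    simp only [Set.mem_ofPred_eq, hQs, hRs] at h
    have h2 := mul_le_mul_of_nonneg_right h.le (sq_nonneg ‖z‖)
    have h3 : (‖z‖⁻¹ ^ 2 * Q z + (k + 1) * (‖z‖⁻¹ ^ 2 * R z)) * ‖z‖ ^ 2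
        = Q z + (k + 1) * R z := by field_simp
    linarith

/-- On a level set of a twice continuously differentiable map, displacements are tangent up to
second order. -/
theorem exists_norm_fderiv_sub_le {E F : Type*} [NormedAddCommGroup E] [NormedSpace ℝ E]
    [NormedAddCommGroup F] [NormedSpace ℝ F] {h : E → F} {a : E} (hd : Differentiable ℝ h)
    (h2 : ContDiffAt ℝ 2 h a) :
    ∃ K : ℝ, 0 ≤ K ∧ ∀ᶠ x in 𝓝 a, h x = h a →
      ‖fderiv ℝ h x (x - a)‖ ≤ K * ‖x - a‖ ^ 2 ∧ ‖fderiv ℝ h a (x - a)‖ ≤ K * ‖x - a‖ ^ 2 := by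
  obtain ⟨K, t, ht, hK⟩ := (h2.fderiv_right (m := 1) (by norm_num)).exists_lipschitzOnWith
  obtain ⟨r, hr, hrt⟩ := Metric.mem_nhds_iff.1 ht
  refine ⟨2 * K, by positivity, ?_⟩
  filter_upwards [Metric.ball_mem_nhds a hr] with x hx hxa
  have hLip : ∀ z ∈ Metric.closedBall a ‖x - a‖, ‖fderiv ℝ h z - fderiv ℝ h a‖ ≤ K * ‖x - a‖ := by
    intro z hz
    rw [mem_closedBall_iff_norm] at hz
    have hz' : z ∈ t := hrt (mem_ball_iff_norm.2 (hz.trans_lt (mem_ball_iff_norm.1 hx)))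
    refine (hK.norm_sub_le hz' (mem_of_mem_nhds ht)).trans ?_
    gcongr
  have hxmem : x ∈ Metric.closedBall a ‖x - a‖ := mem_closedBall_iff_norm.2 le_rfl
  have h1 := (convex_closedBall a ‖x - a‖).norm_image_sub_le_of_norm_fderiv_le' (𝕜 := ℝ) (f := h)
    (fun z _ => hd z) hLip (Metric.mem_closedBall_self (norm_nonneg _)) hxmem
  rw [hxa, sub_self, zero_sub, norm_neg] at h1
  have h3 : ‖(fderiv ℝ h x - fderiv ℝ h a) (x - a)‖ ≤ K * ‖x - a‖ * ‖x - a‖ :=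
    (ContinuousLinearMap.le_opNorm _ _).trans (by gcongr; exact hLip x hxmem)
  have h4 : fderiv ℝ h x (x - a)
      = (fderiv ℝ h x - fderiv ℝ h a) (x - a) + fderiv ℝ h a (x - a) := by simp
  have h5 := norm_add_le ((fderiv ℝ h x - fderiv ℝ h a) (x - a)) (fderiv ℝ h a (x - a))
  rw [← h4] at h5
  have h6 := norm_nonneg (fderiv ℝ h a (x - a))
  constructor <;> nlinarith

theorem inner_mv_transpose {k l : ℕ} (M : Matrix (Fin k) (Fin l) ℝ) (v : Vec k) (u : Vec l) :
    inner ℝ (mv M.transpose v) u = inner ℝ v (mv M u) := by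
  have h := Matrix.toEuclideanLin_conjTranspose_eq_adjoint M
  rw [Matrix.conjTranspose_eq_transpose_of_trivial] at h
  rw [mv, h, LinearMap.adjoint_inner_left]

theorem mv_add {k l : ℕ} (M : Matrix (Fin k) (Fin l) ℝ) (u v : Vec l) :
    mv M (u + v) = mv M u + mv M v :=
  map_add _ u v

theorem mv_sub {k l : ℕ} (M : Matrix (Fin k) (Fin l) ℝ) (u v : Vec l) :
    mv M (u - v) = mv M u - mv M v :=
  map_sub _ u v

theorem mv_smul {k l : ℕ} (M : Matrix (Fin k) (Fin l) ℝ) (t : ℝ) (u : Vec l) :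
    mv M (t • u) = t • mv M u :=
  map_smul _ t u

theorem sum_smul_basisVec {n : ℕ} (u : Vec n) : ∑ i, u i • basisVec i = u := by
  simpa [basisVec] using (EuclideanSpace.basisFun (Fin n) ℝ).sum_repr u

theorem mv_jacobian {n p : ℕ} (c : Vec n → Vec p) (x u : Vec n) :
    mv (jacobian c x) u = fderiv ℝ c x u := by
  conv_rhs => rw [← sum_smul_basisVec u]
  ext j
  simp [mv, jacobian, Matrix.toLpLin_apply, Matrix.mulVec, dotProduct, mul_comm]

theorem dotProduct_hessian_mulVec {n : ℕ} (g : Vec n → ℝ) (x u v : Vec n) :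
    u.ofLp ⬝ᵥ (hessian g x).mulVec v.ofLp = fderiv ℝ (fderiv ℝ g) x u v := by
  conv_rhs => rw [← sum_smul_basisVec u, ← sum_smul_basisVec v]
  simp [hessian, Matrix.mulVec, dotProduct, Finset.mul_sum]
  rw [Finset.sum_comm]
  exact Finset.sum_congr rfl fun i _ => Finset.sum_congr rfl fun j _ => by ring

namespace Problem

variable {n m p q : ℕ} (P : Problem n m p q)

/-- The gradient in `x` of `f + μᵀ c`. -/
def gradLagrangian (x : Vec n) (μ : Vec p) : Vec n :=
  gradient P.f x + mv (jacobian P.c x).transpose μ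

theorem inner_gradLagrangian (x u : Vec n) (μ : Vec p) :
    inner ℝ (P.gradLagrangian x μ) u = fderiv ℝ P.f x u + inner ℝ μ (fderiv ℝ P.c x u) := by
  rw [gradLagrangian, inner_add_left, inner_gradient_left, inner_mv_transpose, mv_jacobian]

theorem norm_gradLagrangian_sub_le (x x' : Vec n) (μ : Vec p) :
    ‖P.gradLagrangian x' μ - P.gradLagrangian x μ‖
      ≤ ‖fderiv ℝ P.f x' - fderiv ℝ P.f x‖ + ‖μ‖ * ‖fderiv ℝ P.c x' - fderiv ℝ P.c x‖ := by
  set E := P.gradLagrangian x' μ - P.gradLagrangian x μ with hE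
  have h : ‖E‖ * ‖E‖ = (fderiv ℝ P.f x' - fderiv ℝ P.f x) E
      + inner ℝ μ ((fderiv ℝ P.c x' - fderiv ℝ P.c x) E) := by
    rw [← real_inner_self_eq_norm_mul_norm]
    conv_lhs => rw [hE, inner_sub_left, ← hE]
    rw [inner_gradLagrangian, inner_gradLagrangian, sub_apply, sub_apply, inner_sub_right]
    ring
  have h1 := (le_abs_self _).trans ((fderiv ℝ P.f x' - fderiv ℝ P.f x).le_opNorm E)
  have h2 := (real_inner_le_norm μ ((fderiv ℝ P.c x' - fderiv ℝ P.c x) E)).trans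
    (mul_le_mul_of_nonneg_left ((fderiv ℝ P.c x' - fderiv ℝ P.c x).le_opNorm E) (norm_nonneg μ))
  rcases (norm_nonneg E).eq_or_lt with h0 | h0
  · rw [← h0]
    positivity
  · refine le_of_mul_le_mul_right ?_ h0
    linarith

/-- The Hessian in `x` of `f + μᵀ c`, as a bilinear form. -/
def hessForm (x : Vec n) (μ : Vec p) : Vec n →L[ℝ] Vec n →L[ℝ] ℝ :=
  fderiv ℝ (fderiv ℝ P.f) x + ∑ j, μ j • fderiv ℝ (fderiv ℝ fun x' => P.c x' j) x

theorem dotProduct_lagrangianHessian_mulVec (x u : Vec n) (μ : Vec p) :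
    u.ofLp ⬝ᵥ (P.lagrangianHessian x μ).mulVec u.ofLp = P.hessForm x μ u u := by
  simp [lagrangianHessian, hessForm, Matrix.add_mulVec, Matrix.sum_mulVec, dotProduct_sum,
    dotProduct_hessian_mulVec, Matrix.smul_mulVec]

theorem hasFDerivAt_fderiv_lagrangian {x : Vec n} {μ : Vec p} (hf : ContDiffAt ℝ 2 P.f x)
    (hc : ContDiffAt ℝ 2 P.c x) :
    HasFDerivAt (fun x' => fderiv ℝ P.f x' + ∑ j, μ j • fderiv ℝ (fun x' => P.c x' j) x')
      (P.hessForm x μ) x := by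
  have h1 := ((hf.fderiv_right (m := 1) (by norm_num)).differentiableAt one_ne_zero).hasFDerivAt
  refine h1.add (HasFDerivAt.fun_sum fun j _ => ?_)
  have hcj : ContDiffAt ℝ 2 (fun x' => P.c x' j) x := by fun_prop
  exact (((hcj.fderiv_right (m := 1) (by norm_num)).differentiableAt
    one_ne_zero).hasFDerivAt).const_smul (μ j)

theorem fderiv_lagrangian_apply (hc : Differentiable ℝ P.c) (x u : Vec n) (μ : Vec p) :
    (fderiv ℝ P.f x + ∑ j, μ j • fderiv ℝ (fun x' => P.c x' j) x) u
      = inner ℝ (P.gradLagrangian x μ) u := by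
  have h : ∀ j, fderiv ℝ (fun x' => P.c x' j) x u = (fderiv ℝ P.c x u) j := fun j => by
    have := ((EuclideanSpace.proj (𝕜 := ℝ) j).hasFDerivAt.comp x (hc x).hasFDerivAt).fderiv
    exact congrArg (fun T => T u) this
  rw [inner_gradLagrangian]
  simp [h, PiLp.inner_apply, mul_comm]

theorem eventually_inner_gradLagrangian_sub_ge {x : Vec n} {μ : Vec p} (hf : ContDiffAt ℝ 2 P.f x)
    (hc : ContDiffAt ℝ 2 P.c x) (hcd : Differentiable ℝ P.c) {δ : ℝ} (hδ : 0 < δ) :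
    ∀ᶠ x' in 𝓝 x, P.hessForm x μ (x' - x) (x' - x) - δ * ‖x' - x‖ ^ 2
      ≤ inner ℝ (P.gradLagrangian x' μ - P.gradLagrangian x μ) (x' - x) := by
  have h := (P.hasFDerivAt_fderiv_lagrangian (μ := μ) hf hc).isLittleO.bound hδ
  filter_upwards [h] with x' hx'
  have h2 := (ContinuousLinearMap.le_of_opNorm_le _ hx' (x' - x))
  rw [sub_apply, sub_apply,
    P.fderiv_lagrangian_apply hcd, P.fderiv_lagrangian_apply hcd, ← inner_sub_left] at h2
  have h3 := (abs_le.1 (Real.norm_eq_abs _ ▸ h2)).1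
  linarith [h3, sq ‖x' - x‖]

theorem continuous_mv {k l : ℕ} (M : Matrix (Fin k) (Fin l) ℝ) : Continuous (mv M) :=
  LinearMap.continuous_of_finiteDimensional _

variable {P} {x : Vec n} {y : Vec m} {μ : Vec p} {lam : Vec q}

theorem IsRegularSolution.hessForm_pos (h : P.IsRegularSolution x y μ lam) {z : Vec n × Vec m}
    (hz : z ≠ 0) (hc : fderiv ℝ P.c x z.1 = 0) (hl : mv P.A z.1 + mv P.B z.2 = 0) :
    0 < P.hessForm x μ z.1 z.1 := by
  rw [← mv_jacobian] at hc
  have hc' := congrArg WithLp.ofLp hc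
  have hl' := congrArg WithLp.ofLp hl
  simp only [mv, Matrix.toLpLin_apply, WithLp.ofLp_zero, WithLp.ofLp_add] at hc' hl'
  have h1 := h.sosc (Sum.elim z.1.ofLp z.2.ofLp)
    (by
      intro h0
      refine hz (Prod.ext ?_ ?_)
      · ext i
        exact congrFun h0 (Sum.inl i)
      · ext i
        exact congrFun h0 (Sum.inr i))
    (by
      rw [constraintJacobian, Matrix.fromBlocks_mulVec]
      simp [hc', hl'])
  rw [Matrix.fromBlocks_mulVec] at h1
  simpa [dotProduct_lagrangianHessian_mulVec] using h1

theorem IsRegularSolution.contDiffAt (h : P.IsRegularSolution x y μ lam) :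
    ContDiffAt ℝ 2 P.f x ∧ ContDiffAt ℝ 2 P.c x := by
  obtain ⟨U, hU, hx, hf, hc⟩ := h.contDiff_two
  exact ⟨hf.contDiffAt (hU.mem_nhds hx), hc.contDiffAt (hU.mem_nhds hx)⟩

/-- Near a regular solution, the gradient of the Lagrangian is strongly monotone relative to that
solution along the feasible set of `c`, up to a multiple of the linear residual. -/
theorem IsRegularSolution.exists_le_inner_gradLagrangian_sub (h : P.IsRegularSolution x y μ lam) :
    ∃ σ α : ℝ, 0 < σ ∧ 0 < α ∧ ∀ᶠ z in 𝓝 (x, μ), P.c z.1 = 0 → ∀ v : Vec m,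
      α * (‖z.1 - x‖ ^ 2 + ‖v‖ ^ 2) ≤
        inner ℝ (P.gradLagrangian z.1 z.2 - P.gradLagrangian x μ) (z.1 - x)
          + σ * ‖mv P.A (z.1 - x) + mv P.B v‖ ^ 2 := by
  have hA := continuous_mv P.A
  have hB := continuous_mv P.B
  obtain ⟨σ, a, hσ, ha, hE⟩ := exists_add_mul_ge_norm_sq (E := Vec n × Vec m)
    (Q := fun z => P.hessForm x μ z.1 z.1)
    (R := fun z => ‖fderiv ℝ P.c x z.1‖ ^ 2 + ‖mv P.A z.1 + mv P.B z.2‖ ^ 2)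
    (by fun_prop) (by fun_prop)
    (by intro t z; simp; ring)
    (by
      intro t z
      simp only [Prod.smul_fst, Prod.smul_snd, map_smul, ← smul_add, norm_smul, mul_pow,
        Real.norm_eq_abs, sq_abs]
      ring)
    (fun z => by positivity)
    (fun z hz hR => by
      have h1 := sq_nonneg ‖fderiv ℝ P.c x z.1‖
      have h2 := sq_nonneg ‖mv P.A z.1 + mv P.B z.2‖
      refine h.hessForm_pos hz ?_ ?_
      · exact norm_eq_zero.1 (pow_eq_zero_iff two_ne_zero |>.1 (by linarith))
      · exact norm_eq_zero.1 (pow_eq_zero_iff two_ne_zero |>.1 (by linarith)))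
  obtain ⟨hf2, hc2⟩ := h.contDiffAt
  have hcd := h.contDiff_c.differentiable one_ne_zero
  obtain ⟨K, hK, hT⟩ := exists_norm_fderiv_sub_le hcd hc2
  have hfst : Tendsto Prod.fst (𝓝 (x, μ)) (𝓝 x) := continuous_fst.tendsto _
  have hsmall1 : ∀ᶠ z : Vec n × Vec p in 𝓝 (x, μ), K * ‖z.2 - μ‖ < a / 8 :=
    Tendsto.eventually_lt_const (by positivity)
      (Continuous.tendsto' (by fun_prop) (x, μ) 0 (by simp))
  have hsmall2 : ∀ᶠ z : Vec n × Vec p in 𝓝 (x, μ), σ * (K * ‖z.1 - x‖) ^ 2 < a / 8 :=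
    Tendsto.eventually_lt_const (by positivity)
      (Continuous.tendsto' (by fun_prop) (x, μ) 0 (by simp))
  refine ⟨σ, a / 4, hσ, by positivity, ?_⟩
  filter_upwards [hsmall1, hsmall2, hfst.eventually hT, hfst.eventually
    (P.eventually_inner_gradLagrangian_sub_ge (μ := μ) hf2 hc2 hcd (δ := a / 8) (by positivity))]
    with z h1 h2 h3 h4 hcz v
  obtain ⟨h5, h6⟩ := h3 (hcz.trans h.kkt.feasible_c.symm)
  have h7 := hE (z.1 - x, v)
  simp only at h7
  set u := z.1 - x
  have hu : ‖u‖ ^ 2 ≤ ‖(u, v)‖ ^ 2 := by gcongr; exact norm_fst_le (u, v)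
  have hv : ‖v‖ ^ 2 ≤ ‖(u, v)‖ ^ 2 := by gcongr; exact norm_snd_le (u, v)
  have h8 : inner ℝ (P.gradLagrangian z.1 z.2 - P.gradLagrangian x μ) u
      = inner ℝ (P.gradLagrangian z.1 μ - P.gradLagrangian x μ) u
        + inner ℝ (z.2 - μ) (fderiv ℝ P.c z.1 u) := by
    simp only [inner_sub_left, inner_gradLagrangian]
    ring
  have h9 : -(a / 8 * ‖u‖ ^ 2) ≤ inner ℝ (z.2 - μ) (fderiv ℝ P.c z.1 u) := by
    have e1 := (abs_le.1 (abs_real_inner_le_norm (z.2 - μ) (fderiv ℝ P.c z.1 u))).1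
    have e2 := mul_le_mul_of_nonneg_left h5 (norm_nonneg (z.2 - μ))
    have e3 := mul_le_mul_of_nonneg_right h1.le (sq_nonneg ‖u‖)
    linarith
  have h10 : σ * ‖fderiv ℝ P.c x u‖ ^ 2 ≤ a / 8 * ‖u‖ ^ 2 := by
    have e1 : ‖fderiv ℝ P.c x u‖ ^ 2 ≤ (K * ‖u‖ ^ 2) ^ 2 := by gcongr
    have e2 := mul_le_mul_of_nonneg_left e1 hσ.le
    have e3 := mul_le_mul_of_nonneg_right h2.le (sq_nonneg ‖u‖)
    linarith
  have h11 := mul_le_mul_of_nonneg_left hu ha.le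
  have h12 := mul_le_mul_of_nonneg_left hv ha.le
  have h13 : 0 ≤ a * ‖(u, v)‖ ^ 2 := by positivity
  linarith

/-- Under the linear independence constraint qualification, convergence of the multipliers follows
from convergence of the stationarity residuals. -/
theorem IsRegularSolution.tendsto_multipliers (h : P.IsRegularSolution x y μ lam)
    {ι : Type*} {l : Filter ι} {μ' : ι → Vec p} {w : ι → Vec q}
    (h1 : Tendsto (fun i => mv (jacobian P.c x).transpose (μ' i) + mv P.A.transpose (w i)) l (𝓝 0))
    (h2 : ∀ᶠ i in l, mv P.B.transpose (w i) = 0) :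
    Tendsto μ' l (𝓝 0) ∧ Tendsto w l (𝓝 0) := by
  let T : Vec p × Vec q →ₗ[ℝ] Vec n × Vec m :=
    (LinearMap.coprod (Matrix.toEuclideanLin (jacobian P.c x).transpose)
      (Matrix.toEuclideanLin P.A.transpose)).prod
      ((Matrix.toEuclideanLin P.B.transpose).comp (LinearMap.snd ℝ _ _))
  have hT : T.ker = ⊥ := by
    rw [LinearMap.ker_eq_bot']
    intro s hs
    have e1 : mv (jacobian P.c x).transpose s.1 + mv P.A.transpose s.2 = 0 := congrArg Prod.fst hs
    have e2 : mv P.B.transpose s.2 = 0 := congrArg Prod.snd hs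
    replace e1 := congrArg WithLp.ofLp e1
    replace e2 := congrArg WithLp.ofLp e2
    simp only [mv, Matrix.toLpLin_apply, WithLp.ofLp_add, Matrix.mulVec_transpose,
      WithLp.ofLp_zero] at e1 e2
    have e3 : Sum.elim s.1.ofLp s.2.ofLp = 0 := by
      refine Matrix.vecMul_injective_iff.2 h.licq ?_
      simp only [constraintJacobian, Matrix.vecMul_fromBlocks, Matrix.zero_vecMul]
      simp [e1, e2]
    refine Prod.ext ?_ ?_
    · ext i
      exact congrFun e3 (Sum.inl i)
    · ext i
      exact congrFun e3 (Sum.inr i)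
  have hconv : Tendsto (fun i => T (μ' i, w i)) l (𝓝 (T 0)) := by
    rw [map_zero]
    exact h1.prodMk_nhds (tendsto_const_nhds.congr' (h2.mono fun i hi => hi.symm))
  have := (LinearMap.isClosedEmbedding_of_injective hT).isInducing.tendsto_nhds_iff.2 hconv
  exact ⟨(continuous_fst.tendsto _).comp this, (continuous_snd.tendsto _).comp this⟩

/-- First-order optimality in the `y`-step. -/
theorem mv_transpose_eq_zero_of_isMinOn {ρ : ℝ} (hρ : 0 < ρ) {lam : Vec q} {x : Vec n} {y : Vec m}
    (h : IsMinOn (fun y' => P.penalty ρ lam x y') Set.univ y) :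
    mv P.B.transpose (lam + ρ • P.linRes x y) = 0 := by
  set g := mv P.B.transpose (lam + ρ • P.linRes x y) with hg
  have hexp : ∀ t : ℝ, P.penalty ρ lam x (y + t • g)
      = P.penalty ρ lam x y + t * ‖g‖ ^ 2 + ρ / 2 * t ^ 2 * ‖mv P.B g‖ ^ 2 := by
    intro t
    have e1 : P.linRes x (y + t • g) = P.linRes x y + t • mv P.B g := by
      simp only [linRes, mv_add, mv_smul]
      abel
    have e2 : ‖g‖ ^ 2 = inner ℝ lam (mv P.B g) + ρ * inner ℝ (P.linRes x y) (mv P.B g) := by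
      rw [← real_inner_self_eq_norm_sq]
      conv_lhs => rw [hg, inner_mv_transpose, ← hg]
      rw [inner_add_left, real_inner_smul_left]
    rw [penalty, penalty, e1, e2, norm_add_sq_real, inner_add_right, real_inner_smul_right,
      real_inner_smul_right, norm_smul, mul_pow, Real.norm_eq_abs, sq_abs]
    ring
  by_contra hne
  have hG : 0 < ‖g‖ ^ 2 := by positivity
  have hd : 0 < ρ * ‖mv P.B g‖ ^ 2 + 1 := by positivity
  have h2 := isMinOn_iff.1 h (y + (-(‖g‖ ^ 2 / (ρ * ‖mv P.B g‖ ^ 2 + 1))) • g) (Set.mem_univ _)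
  rw [hexp] at h2
  set G := ‖g‖ ^ 2
  set d := ρ * ‖mv P.B g‖ ^ 2 + 1 with hd'
  have h3 : ρ / 2 * (-(G / d)) ^ 2 * ‖mv P.B g‖ ^ 2 = (d - 1) / 2 * (G / d) ^ 2 := by
    rw [hd']
    ring
  have h4 : G = d * (G / d) := by field_simp
  have h5 : 0 < G / d := by positivity
  rw [h3] at h2
  have h6 : 0 < d * (G / d) ^ 2 := by positivity
  have h7 : -(G / d) * G = -(d * (G / d) ^ 2) := by
    field_simp
  nlinarith [sq_nonneg (G / d)]

variable {ρ : ℝ} {x : ℕ → Vec n} {y : ℕ → Vec m} {lam : ℕ → Vec q}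

theorem IsADMMSequence.mv_transpose_lam (h : P.IsADMMSequence ρ x y lam) (hρ : 0 < ρ) (k : ℕ) :
    mv P.B.transpose (lam k) = 0 := by
  cases k with
  | zero => exact h.init
  | succ k =>
    rw [h.lam_step k]
    exact mv_transpose_eq_zero_of_isMinOn hρ (h.y_step k)

variable {xs : Vec n} {ys : Vec m} {μs : Vec p} {lams : Vec q}

/-- The Lyapunov function of ADMM. -/
def lyapunov (P : Problem n m p q) (ρ : ℝ) (v : Vec m) (w : Vec q) : ℝ :=
  ‖w‖ ^ 2 / (2 * ρ) + ρ / 2 * ‖mv P.B v‖ ^ 2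

theorem IsKKT.linRes_eq (h : P.IsKKT xs ys μs lams) (x : Vec n) (y : Vec m) :
    P.linRes x y = mv P.A (x - xs) + mv P.B (y - ys) := by
  rw [linRes, ← h.feasible_lin, mv_sub, mv_sub]
  abel

/-- The stationarity condition of the `x`-step, relative to a KKT point. -/
theorem IsADMMSequence.stationary_sub (h : P.IsADMMSequence ρ x y lam)
    (hs : P.IsKKT xs ys μs lams) {k : ℕ} {μ : Vec p}
    (hk : P.IsSubproblemKKT ρ (y k) (lam k) (x (k + 1)) μ) :
    P.gradLagrangian (x (k + 1)) μ - P.gradLagrangian xs μs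
      + mv P.A.transpose (lam (k + 1) - lams)
      + ρ • mv P.A.transpose (mv P.B (y k - y (k + 1))) = 0 := by
  have e1 : lam k + ρ • P.linRes (x (k + 1)) (y k)
      = lam (k + 1) + ρ • mv P.B (y k - y (k + 1)) := by
    rw [h.lam_step k, linRes, linRes, mv_sub, add_assoc, ← smul_add]
    congr 2
    abel
  have e2 := hk.stationary
  rw [e1, mv_add, mv_smul] at e2
  have e3 := hs.stationary_x
  rw [mv_sub, gradLagrangian, gradLagrangian]
  rw [← sub_eq_zero_of_eq (e2.trans e3.symm)]
  abel

theorem IsADMMSequence.lyapunov_succ (h : P.IsADMMSequence ρ x y lam) (hρ : 0 < ρ)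
    (hs : P.IsKKT xs ys μs lams) {k : ℕ} {μ : Vec p}
    (hk : P.IsSubproblemKKT ρ (y k) (lam k) (x (k + 1)) μ) :
    P.lyapunov ρ (y (k + 1) - ys) (lam (k + 1) - lams)
      + inner ℝ (P.gradLagrangian (x (k + 1)) μ - P.gradLagrangian xs μs) (x (k + 1) - xs)
      + ρ / 2 * ‖mv P.A (x (k + 1) - xs) + mv P.B (y (k + 1) - ys)‖ ^ 2
      ≤ P.lyapunov ρ (y k - ys) (lam k - lams) := by
  have hB : ∀ (j : ℕ) (v : Vec m), inner ℝ (lam j - lams) (mv P.B v) = 0 := fun j v => by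
    rw [← inner_mv_transpose, mv_sub, h.mv_transpose_lam hρ, hs.stationary_y, sub_zero,
      inner_zero_left]
  have hst := congrArg (fun z => inner ℝ z (x (k + 1) - xs)) (h.stationary_sub hs hk)
  simp only [inner_add_left, inner_zero_left, real_inner_smul_left] at hst
  rw [inner_mv_transpose, inner_mv_transpose] at hst
  have hw : lam k - lams = (lam (k + 1) - lams)
      - ρ • (mv P.A (x (k + 1) - xs) + mv P.B (y (k + 1) - ys)) := by
    rw [h.lam_step k, hs.linRes_eq]
    abel
  have hyk : mv P.B (y k - ys) = mv P.B (y (k + 1) - ys) + mv P.B (y k - y (k + 1)) := by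
    rw [← mv_add, sub_add_eq_add_sub, add_sub_cancel]
  have h0 := hB k (y k - y (k + 1))
  have h1 := hB (k + 1) (y k - y (k + 1))
  have h2 := hB (k + 1) (y (k + 1) - ys)
  rw [lyapunov, lyapunov, hyk, hw]
  rw [hw] at h0
  generalize hdB : mv P.B (y k - y (k + 1)) = d at *
  generalize mv P.B (y (k + 1) - ys) = v at *
  generalize mv P.A (x (k + 1) - xs) = a at *
  generalize lam (k + 1) - lams = w at *
  generalize inner ℝ (P.gradLagrangian (x (k + 1)) μ - P.gradLagrangian xs μs)
    (x (k + 1) - xs) = e at *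
  have h3 : inner ℝ d a = - inner ℝ d v := by
    rw [inner_sub_left, h1, real_inner_smul_left, inner_add_left] at h0
    have := (mul_eq_zero.1 (neg_eq_zero.1 (by linarith : -(ρ * (inner ℝ a d + inner ℝ v d)) = 0)))
    rw [real_inner_comm, real_inner_comm v d]
    linarith [this.resolve_left hρ.ne']
  rw [norm_sub_sq_real, norm_add_sq_real v d, inner_smul_right, norm_smul, mul_pow,
    inner_add_right, h2, Real.norm_eq_abs, sq_abs, real_inner_comm d v]
  rw [h3] at hst
  have h4 : (‖w‖ ^ 2 - 2 * (ρ * (inner ℝ w a + 0)) + ρ ^ 2 * ‖a + v‖ ^ 2) / (2 * ρ)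
      = ‖w‖ ^ 2 / (2 * ρ) - inner ℝ w a + ρ / 2 * ‖a + v‖ ^ 2 := by
    field_simp
    ring
  rw [h4]
  have h5 : 0 ≤ ρ / 2 * ‖d‖ ^ 2 := by positivity
  linarith

/-- ADMM iterates that remain in a region of relative strong monotonicity converge in `(x, y)`. -/
theorem IsADMMSequence.tendsto_primal (h : P.IsADMMSequence ρ x y lam) (hρ : 0 < ρ)
    (hs : P.IsKKT xs ys μs lams) {μ : ℕ → Vec p}
    (hk : ∀ k, P.IsSubproblemKKT ρ (y k) (lam k) (x (k + 1)) (μ (k + 1))) {α : ℝ} (hα : 0 < α)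
    (hmono : ∀ᶠ k in atTop, α * (‖x (k + 1) - xs‖ ^ 2 + ‖y (k + 1) - ys‖ ^ 2) ≤
      inner ℝ (P.gradLagrangian (x (k + 1)) (μ (k + 1)) - P.gradLagrangian xs μs) (x (k + 1) - xs)
        + ρ / 2 * ‖mv P.A (x (k + 1) - xs) + mv P.B (y (k + 1) - ys)‖ ^ 2) :
    Tendsto x atTop (𝓝 xs) ∧ Tendsto y atTop (𝓝 ys) := by
  obtain ⟨N, hN⟩ := eventually_atTop.1 hmono
  set V : ℕ → ℝ := fun k => P.lyapunov ρ (y (k + N) - ys) (lam (k + N) - lams) with hV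
  have hstep : ∀ k, α * (‖x (k + N + 1) - xs‖ ^ 2 + ‖y (k + N + 1) - ys‖ ^ 2)
      ≤ V k - V (k + 1) := fun k => by
    have h1 := hN (k + N) (Nat.le_add_left N k)
    have h2 := h.lyapunov_succ hρ hs (hk (k + N))
    simp only [hV, show k + 1 + N = k + N + 1 by ring]
    linarith
  have hanti : Antitone V := antitone_nat_of_succ_le fun k => by
    have h1 : 0 ≤ α * (‖x (k + N + 1) - xs‖ ^ 2 + ‖y (k + N + 1) - ys‖ ^ 2) := by positivity
    linarith [hstep k]
  have hbdd : BddBelow (Set.range V) := ⟨0, by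
    rintro _ ⟨k, rfl⟩
    simp only [hV, lyapunov]
    positivity⟩
  have hlim := tendsto_atTop_ciInf hanti hbdd
  have hdiff : Tendsto (fun k => (V k - V (k + 1)) / α) atTop (𝓝 0) := by
    simpa using (hlim.sub ((tendsto_add_atTop_iff_nat 1).2 hlim)).div_const α
  have hsq : ∀ {E : Type} [NormedAddCommGroup E] (z : ℕ → E) (a : E),
      (∀ k, ‖z (k + N + 1) - a‖ ^ 2 ≤ (V k - V (k + 1)) / α) → Tendsto z atTop (𝓝 a) := by
    intro E _ z a hz
    rw [← tendsto_add_atTop_iff_nat (N + 1), tendsto_iff_norm_sub_tendsto_zero]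
    have h1 := squeeze_zero (fun k => sq_nonneg _) hz hdiff
    simpa [Real.sqrt_sq, add_assoc] using h1.sqrt
  constructor
  · refine hsq x xs fun k => ?_
    rw [le_div_iff₀ hα]
    nlinarith [hstep k, sq_nonneg ‖y (k + N + 1) - ys‖]
  · refine hsq y ys fun k => ?_
    rw [le_div_iff₀ hα]
    nlinarith [hstep k, sq_nonneg ‖x (k + N + 1) - xs‖]

/-- Primal convergence of ADMM with bounded multipliers of `c` implies dual convergence. -/
theorem IsADMMSequence.tendsto_dual (h : P.IsADMMSequence ρ x y lam) (hρ : 0 < ρ)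
    (hreg : P.IsRegularSolution xs ys μs lams) {μ : ℕ → Vec p}
    (hk : ∀ k, P.IsSubproblemKKT ρ (y k) (lam k) (x (k + 1)) (μ (k + 1)))
    (hx : Tendsto x atTop (𝓝 xs)) (hy : Tendsto y atTop (𝓝 ys)) {M : ℝ}
    (hμ : ∀ᶠ k in atTop, ‖μ (k + 1)‖ ≤ M) :
    Tendsto (fun k => μ (k + 1)) atTop (𝓝 μs) ∧ Tendsto (fun k => lam (k + 1)) atTop (𝓝 lams) := by
  have hx1 := (tendsto_add_atTop_iff_nat 1).2 hx
  have hy1 := (tendsto_add_atTop_iff_nat 1).2 hy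
  have hAt := continuous_mv P.A.transpose
  have hBc := continuous_mv P.B
  have hG : Tendsto (fun k => P.gradLagrangian (x (k + 1)) (μ (k + 1))
      - P.gradLagrangian xs (μ (k + 1))) atTop (𝓝 0) := by
    have hcont : Continuous fun z => ‖fderiv ℝ P.f z - fderiv ℝ P.f xs‖
        + M * ‖fderiv ℝ P.c z - fderiv ℝ P.c xs‖ := by
      have h1 := hreg.contDiff_f.continuous_fderiv one_ne_zero
      have h2 := hreg.contDiff_c.continuous_fderiv one_ne_zero
      fun_prop
    have h3 := (hcont.tendsto xs).comp hx1
    simp only [sub_self, norm_zero, mul_zero, add_zero] at h3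
    refine squeeze_zero_norm' (hμ.mono fun k hM => ?_) h3
    refine (P.norm_gradLagrangian_sub_le _ _ _).trans ?_
    simp only [Function.comp]
    gcongr
  have hD : Tendsto (fun k => ρ • mv P.A.transpose (mv P.B (y k - y (k + 1)))) atTop (𝓝 0) := by
    have hc : Continuous fun v : Vec m => ρ • mv P.A.transpose (mv P.B v) := by fun_prop
    have h1 := (hc.tendsto _).comp (hy.sub hy1)
    simpa [Function.comp_def] using h1
  have h1 : Tendsto (fun k => mv (jacobian P.c xs).transpose (μ (k + 1) - μs)
      + mv P.A.transpose (lam (k + 1) - lams)) atTop (𝓝 0) := by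
    have h2 := (hG.add hD).neg
    rw [add_zero, neg_zero] at h2
    refine h2.congr fun k => ?_
    have h3 := h.stationary_sub hreg.kkt (hk k)
    rw [neg_eq_iff_eq_neg, ← sub_eq_zero, sub_neg_eq_add, ← h3,
      mv_sub (jacobian P.c xs).transpose]
    simp only [gradLagrangian]
    abel
  have h2 := hreg.tendsto_multipliers h1 (Eventually.of_forall fun k => by
    rw [mv_sub, h.mv_transpose_lam hρ, hreg.kkt.stationary_y, sub_zero])
  exact ⟨tendsto_sub_nhds_zero_iff.1 h2.1, tendsto_sub_nhds_zero_iff.1 h2.2⟩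

end Problem

theorem norm_sub_lt_of_primalDualDist_lt {n m p q : ℕ} {x x' : Vec n} {y y' : Vec m}
    {μ μ' : Vec p} {lam lam' : Vec q} {ε : ℝ} (h : primalDualDist x x' y y' μ μ' lam lam' < ε) :
    ‖x - x'‖ < ε ∧ ‖μ - μ'‖ < ε := by
  have hx := sq_nonneg ‖x - x'‖
  have hy := sq_nonneg ‖y - y'‖
  have hμ := sq_nonneg ‖μ - μ'‖
  have hlam := sq_nonneg ‖lam - lam'‖
  exact ⟨(Real.le_sqrt_of_sq_le (by linarith)).trans_lt h,
    (Real.le_sqrt_of_sq_le (by linarith)).trans_lt h⟩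

end ADMM

end

theorem mainTheorem3 {n m p q : ℕ} (P : ADMM.Problem n m p q)
    (xs : ADMM.Vec n) (ys : ADMM.Vec m) (μs : ADMM.Vec p) (lams : ADMM.Vec q)
    (hreg : P.IsRegularSolution xs ys μs lams) :
    ∃ ε ρs : ℝ, 0 < ε ∧ 0 < ρs ∧
      ∀ ρ : ℝ, ρs < ρ →
      ∀ (x : ℕ → ADMM.Vec n) (y : ℕ → ADMM.Vec m) (μ : ℕ → ADMM.Vec p) (lam : ℕ → ADMM.Vec q),
        P.IsADMMSequence ρ x y lam →
        (∀ k, P.IsSubproblemKKT ρ (y k) (lam k) (x (k + 1)) (μ (k + 1))) →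
        (∀ᶠ k in Filter.atTop, ADMM.primalDualDist (x (k + 1)) xs (y (k + 1)) ys
          (μ (k + 1)) μs (lam (k + 1)) lams < ε) →
        Filter.Tendsto (fun k => (x (k + 1), y (k + 1), μ (k + 1), lam (k + 1)))
          Filter.atTop (nhds (xs, ys, μs, lams)) := by
  obtain ⟨σ, α, hσ, hα, hev⟩ := hreg.exists_le_inner_gradLagrangian_sub
  obtain ⟨ε, hε, hball⟩ := Metric.eventually_nhds_iff.1 hev
  refine ⟨ε, 2 * σ, hε, by positivity, fun ρ hρ x y μ lam hseq hkkt hnear => ?_⟩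
  have hρ0 : 0 < ρ := by linarith
  obtain ⟨hx, hy⟩ := hseq.tendsto_primal hρ0 hreg.kkt hkkt hα (hnear.mono fun k hk => by
    obtain ⟨h1, h2⟩ := ADMM.norm_sub_lt_of_primalDualDist_lt hk
    have h3 : dist (x (k + 1), μ (k + 1)) (xs, μs) < ε := by
      rw [Prod.dist_eq, dist_eq_norm, dist_eq_norm]
      exact max_lt h1 h2
    refine (hball h3 (hkkt k).feasible (y (k + 1) - ys)).trans ?_
    gcongr
    linarith)
  obtain ⟨hμ, hlam⟩ := hseq.tendsto_dual hρ0 hreg hkkt hx hy (M := ‖μs‖ + ε)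
    (hnear.mono fun k hk => by
      have h1 := norm_add_le μs (μ (k + 1) - μs)
      rw [add_sub_cancel] at h1
      linarith [(ADMM.norm_sub_lt_of_primalDualDist_lt hk).2])
  exact ((Filter.tendsto_add_atTop_iff_nat 1).2 hx).prodMk_nhds
    (((Filter.tendsto_add_atTop_iff_nat 1).2 hy).prodMk_nhds (hμ.prodMk_nhds hlam))
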